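/- Let $q$ be a prime power. A deterministic finite automaton with output over the digit alphabet $\{0,\dots,q-1\}$ generates a sequence ${\bf a}=(a_n)_{n\ge 0}$ in reverse reading if, for every $n$ and every base-$q$ expansion of $n$ (leading zeros allowed), its output after reading the expansion starting with the least significant digit is $a_n$. Let ${\rm comp}_q({\bf a})$ denote the minimal number of states of such an automaton. For a power series $f\in\mathbb F_q[[x]]$ that is algebraic over $\mathbb F_q(x)$, the degree of $f$ is $[\mathbb F_q(x)(f):\mathbb F_q(x)]$, and the height of $f$ is the minimal degree in $x$ of a nonzero polynomial $P(x,y)\in\mathbb F_q[x,y]$ with $P(x,f(x))=0$. **Theorem.** There is a real-valued function $\varepsilon(q,h,d)$, depending only on $q$, $h$ and $d$ and tending to $0$ as any of $q,h,d$ grows (for every $\eta>0$ there is $N$ such that $|\varepsilon(q,h,d)|\le\eta$ whenever $\max(q,h,d)\ge N$), with the following property. For every prime power $q$ and every algebraic power series $f(x)=\sum_{n\ge 0}a_nx^n\in\mathbb F_q[[x]]$ of degree $d$ and height $h$, the sequence ${\bf a}=(a_n)_{n\ge0}$ is generated in reverse reading by a finite automaton, and $$ {\rm comp}_q({\bf a})\le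 (1+\varepsilon(q,h,d))\,q^{(h+1)d+1}. $$ -/

import Mathlib

open Polynomial PowerSeries LaurentSeries IntermediateField
open scoped RatFunc

noncomputable section

/-- A deterministic automaton with output: states `σ`, input alphabet `α`, output alphabet `β`. -/
structure DFAO (α σ β : Type*) where
  /-- the transition function -/
  step : σ → α → σ
  /-- the initial state -/
  start : σ
  /-- the output function -/
  output : σ → β

/-- The output of the automaton after it has read the word `w` from left to right. -/
def DFAO.run {α σ β : Type*} (M : DFAO α σ β) (w : List α) : β :=
  M.output (w.foldl M.step M.start)

/-- The natural number whose base-`q` digits are the letters of `w`, the first letter being the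
least significant digit. The last letters, the most significant digits, may be zeros. -/
def wordValue {q : ℕ} (w : List (Fin q)) : ℕ :=
  Nat.ofDigits q (w.map fun i : Fin q => (i : ℕ))

/-- The automaton `M` generates the sequence `a` in reverse reading: on every base-`q` expansion
of `n` (padded with zeros or not), read from the least significant digit on, its output
is `a n`. -/
def DFAO.GeneratesReverse {q : ℕ} {σ β : Type*} (M : DFAO (Fin q) σ β) (a : ℕ → β) : Prop :=
  ∀ w : List (Fin q), M.run w = a (wordValue w)

/-- The sequence `a` is generated in reverse reading by a finite automaton with `m` states. -/
def GeneratedWithStates {β : Type*} (q : ℕ) (a : ℕ → β) (m : ℕ) : Prop :=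
  ∃ M : DFAO (Fin q) (Fin m) β, M.GeneratesReverse a

/-- `a` is `q`-automatic (in reverse reading). -/
def IsAutomaticReverse {β : Type*} (q : ℕ) (a : ℕ → β) : Prop :=
  ∃ m : ℕ, GeneratedWithStates q a m

/-- `comp_q(a)`: the number of states of a minimal finite automaton generating `a` in reverse
reading. It is meaningful when `a` is `q`-automatic. -/
def reverseComplexity {β : Type*} (q : ℕ) (a : ℕ → β) : ℕ :=
  sInf {m : ℕ | GeneratedWithStates q a m}

/-- The power series `f` is algebraic over the field of rational functions `F(x)`, inside
the field of Laurent series over `F`. -/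
def IsAlgebraicSeries {F : Type*} [Field F] (f : F⟦X⟧) : Prop :=
  IsAlgebraic (RatFunc F) (f : F⸨X⸩)

/-- The degree of `f`: the degree `[F(x)(f) : F(x)]`. -/
def seriesDegree {F : Type*} [Field F] (f : F⟦X⟧) : ℕ :=
  Module.finrank (RatFunc F) (adjoin (RatFunc F) {(f : F⸨X⸩)})

/-- The degree in `x` of `P(x, y)`, viewed as a polynomial in `y` over `F[x]`. -/
def degreeInX {F : Type*} [Field F] (P : F[X][X]) : ℕ :=
  P.support.sup fun i => (P.coeff i).natDegree

/-- The height of `f`: the minimal degree in `x` of a nonzero polynomial `P(x, y)` such that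
`P(x, f(x)) = 0`. -/
def seriesHeight {F : Type*} [Field F] (f : F⟦X⟧) : ℕ :=
  sInf {h : ℕ | ∃ P : F[X][X], P ≠ 0 ∧ Polynomial.aeval f P = 0 ∧ degreeInX P = h}

end

/-!
Write `q` for the cardinality of the field `F`. After the digits `r₁, …, r_k` have been read, least
significant first, what remains of the sequence is the coefficient sequence of
`Λ_{r_k} ⋯ Λ_{r₁} f`, where `Λ_r (∑ aₙ xⁿ) = ∑ a_{qn+r} xⁿ` (`sectionOp`). Hence any finite set of
power series that contains `f` and is stable under the `Λ_r` is the set of states of an automaton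
generating the coefficients of `f` (`generatedWithStates_ncard`).

Let `P(x, y)` be an irreducible polynomial with root `f`, of degree `d` in `y` and at most `h` in
`x`. It is separable in `y`. Indeed `P` divides every polynomial that vanishes at `f`
(`dvd_of_aeval_eq_zero`). If `P_y(x, f) = 0`, comparing degrees gives `P_y = 0`; differentiating
`P(x, f) = 0` then gives `P_x(x, f) = 0`, so that `P_x = 0` as well, and `P` is a `p`-th power
because `F` is perfect (`aeval_derivative_ne_zero`).

Consider the series `g = A(x, f) / P_y(x, f)`. With `Λ_{r,q-1}` the operator that picks the
coefficients of the `x^{qi+r} y^{qj+q-1}` (`cartierOp`), one has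
`Λ_r g = B(x, f) / P_y(x, f)`, where `B = Λ_{r,q-1}(A P^{q-1})`.
This is the compatibility of the Cartier operator with the residue of `A / P dy` at `y = f`, and it
is checked directly: write `P = (y - f) Q`. Modulo `(y - f)^q`, the polynomial `A P^{q-1}` is
`(y - f)^{q-1}` times the constant `A(f) Q(f)^{q-1} = g Q(f)^q`; the multiples of `(y - f)^q` are
sent to multiples of `y - f`, and only the leading coefficient of `(y - f)^{q-1}` is seen by
`Λ_{r,q-1}` (`eval_cartierOp`).

If `A` has degree at most `h` in `x` and at most `d` in `y`, then `B` has degree at most `h` in `x`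
and less than `d` in `y` (`sectionOp_mem_residueSet`). Starting from
`f = (y P_y)(x, f) / P_y(x, f)`, every state other than `f` therefore comes from one of the
`q^{(h+1)d}` polynomials with these degree bounds. So `q^{(h+1)d} + 1 ≤ q^{(h+1)d+1}` states
suffice, and the error term `ε` may be taken to be `0`.
-/

noncomputable section

variable {F : Type*}

/-! ### Section operators on power series -/

/-- The section operator `Λ_r`, sending `∑ aₙ xⁿ` to `∑ a_{qn+r} xⁿ`. -/
def sectionOp [Semiring F] (q r : ℕ) (g : F⟦X⟧) : F⟦X⟧ :=
  PowerSeries.mk fun n => PowerSeries.coeff (q * n + r) g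

@[simp]
theorem coeff_sectionOp [Semiring F] (q r n : ℕ) (g : F⟦X⟧) :
    PowerSeries.coeff n (sectionOp q r g) = PowerSeries.coeff (q * n + r) g :=
  PowerSeries.coeff_mk _ _

theorem sectionOp_add [Semiring F] (q r : ℕ) (g k : F⟦X⟧) :
    sectionOp q r (g + k) = sectionOp q r g + sectionOp q r k := by
  ext n; simp

theorem sectionOp_sub [Ring F] (q r : ℕ) (g k : F⟦X⟧) :
    sectionOp q r (g - k) = sectionOp q r g - sectionOp q r k := by
  ext n; simp

@[simp]
theorem sectionOp_zero [Semiring F] (q r : ℕ) : sectionOp q r (0 : F⟦X⟧) = 0 := by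
  ext n; simp

theorem sectionOp_C_mul [Semiring F] (q r : ℕ) (a : F) (g : F⟦X⟧) :
    sectionOp q r (PowerSeries.C a * g) = PowerSeries.C a * sectionOp q r g := by
  ext n; simp

theorem sectionOp_X_pow_mul [Semiring F] {q r : ℕ} (hr : r < q) (g : F⟦X⟧) :
    sectionOp q r (PowerSeries.X ^ q * g) = PowerSeries.X * sectionOp q r g := by
  ext n
  rcases n with _ | n
  · simp [PowerSeries.coeff_X_pow_mul', hr]
  · have h : q * (n + 1) + r - q = q * n + r := by rw [mul_add]; omega
    rw [coeff_sectionOp, PowerSeries.coeff_X_pow_mul', if_pos (by rw [mul_add]; omega), h,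
      PowerSeries.coeff_succ_X_mul, coeff_sectionOp]

/-- The operator `Λ_r` is linear over the `q`-th powers, up to extraction of the `q`-th root. Since
`u ^ q = u(x ^ q)`, the case of a constant and that of `u = x` imply the general one. -/
theorem sectionOp_pow_card_mul [Field F] [Fintype F] {r : ℕ} (hr : r < Fintype.card F)
    (u v : F⟦X⟧) :
    sectionOp (Fintype.card F) r (u ^ Fintype.card F * v) =
      u * sectionOp (Fintype.card F) r v := by
  ext n
  induction n using Nat.strong_induction_on generalizing u with
  | _ n ih =>
    obtain ⟨p, hp⟩ := CharP.exists F
    obtain ⟨k, hpp, hk⟩ := FiniteField.card F p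
    have : Fact p.Prime := ⟨hpp⟩
    have : CharP F⟦X⟧ p := charP_of_injective_algebraMap (algebraMap F F⟦X⟧).injective p
    obtain ⟨w, a, hu⟩ : ∃ w a, u = PowerSeries.X * w + PowerSeries.C a :=
      ⟨_, _, PowerSeries.eq_X_mul_shift_add_const u⟩
    have hpow : u ^ Fintype.card F = PowerSeries.X ^ Fintype.card F * w ^ Fintype.card F
        + PowerSeries.C a := by
      rw [hu, hk, add_pow_char_pow, ← hk, mul_pow, ← map_pow, FiniteField.pow_card]
    rw [hpow, hu, add_mul, add_mul, sectionOp_add, sectionOp_C_mul, mul_assoc, mul_assoc,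
      sectionOp_X_pow_mul hr, map_add, map_add]
    congr 1
    rcases n with _ | n
    · simp
    · rw [PowerSeries.coeff_succ_X_mul, PowerSeries.coeff_succ_X_mul, ih n (Nat.lt_succ_self n)]

/-! ### The Cartier operator on polynomials over power series -/

/-- The operator `Λ_{r,q-1}` on polynomials in `y` over `F⟦x⟧`: it picks the coefficients of the
monomials `x ^ (q i + r) y ^ (q j + q - 1)` and makes them the coefficients of `x ^ i y ^ j`.
The range of summation only serves to make the sum finite, see `coeff_cartierOp`. -/
def cartierOp [Semiring F] (q r : ℕ) (V : F⟦X⟧[X]) : F⟦X⟧[X] :=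
  ∑ j ∈ Finset.range (V.natDegree + 1),
    Polynomial.monomial j (sectionOp q r (V.coeff (q * j + (q - 1))))

theorem coeff_cartierOp [Semiring F] {q : ℕ} (hq : 0 < q) (r j : ℕ) (V : F⟦X⟧[X]) :
    (cartierOp q r V).coeff j = sectionOp q r (V.coeff (q * j + (q - 1))) := by
  simp only [cartierOp, Polynomial.finsetSum_coeff, Polynomial.coeff_monomial,
    Finset.sum_ite_eq', Finset.mem_range]
  split_ifs with h
  · rfl
  · have : j ≤ q * j := Nat.le_mul_of_pos_left j hq
    rw [Polynomial.coeff_eq_zero_of_natDegree_lt (by omega), sectionOp_zero]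

theorem cartierOp_add [Semiring F] {q : ℕ} (hq : 0 < q) (r : ℕ) (V W : F⟦X⟧[X]) :
    cartierOp q r (V + W) = cartierOp q r V + cartierOp q r W := by
  ext1 j
  simp only [coeff_cartierOp hq, Polynomial.coeff_add, sectionOp_add]

/-- The case `U = y - f` of the semilinearity `Λ_{r,q-1} (U ^ q * W) = U * Λ_{r,q-1} W`. -/
theorem cartierOp_X_sub_C_pow_card_mul [Field F] [Fintype F] {r : ℕ} (hr : r < Fintype.card F)
    (f : F⟦X⟧) (W : F⟦X⟧[X]) :
    cartierOp (Fintype.card F) r ((Polynomial.X - Polynomial.C f) ^ Fintype.card F * W) =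
      (Polynomial.X - Polynomial.C f) * cartierOp (Fintype.card F) r W := by
  have hq : 0 < Fintype.card F := Fintype.card_pos
  obtain ⟨p, hp⟩ := CharP.exists F
  obtain ⟨k, hpp, hk⟩ := FiniteField.card F p
  have : Fact p.Prime := ⟨hpp⟩
  have : CharP F⟦X⟧ p := charP_of_injective_algebraMap (algebraMap F F⟦X⟧).injective p
  have hpow : (Polynomial.X - Polynomial.C f) ^ Fintype.card F =
      Polynomial.X ^ Fintype.card F - Polynomial.C (f ^ Fintype.card F) := by
    rw [hk, sub_pow_char_pow, ← map_pow]
  ext1 j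
  rw [coeff_cartierOp hq, hpow, sub_mul, sub_mul, Polynomial.coeff_sub, Polynomial.coeff_sub,
    Polynomial.coeff_C_mul, Polynomial.coeff_C_mul, sectionOp_sub, sectionOp_pow_card_mul hr,
    coeff_cartierOp hq]
  congr 1
  rcases j with _ | j
  · rw [Polynomial.coeff_X_pow_mul', if_neg (by omega), sectionOp_zero]
    simp
  · have h : Fintype.card F * (j + 1) + (Fintype.card F - 1) - Fintype.card F =
        Fintype.card F * j + (Fintype.card F - 1) := by rw [mul_add]; omega
    rw [Polynomial.coeff_X_pow_mul', if_pos (by rw [mul_add]; omega), h, Polynomial.coeff_X_mul,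
      coeff_cartierOp hq]

theorem cartierOp_X_sub_C_pow_mul_C [Field F] {q : ℕ} (hq : 0 < q) (r : ℕ) (f c : F⟦X⟧) :
    cartierOp q r ((Polynomial.X - Polynomial.C f) ^ (q - 1) * Polynomial.C c) =
      Polynomial.C (sectionOp q r c) := by
  have hdeg : ((Polynomial.X - Polynomial.C f) ^ (q - 1)).natDegree = q - 1 := by
    rw [Polynomial.natDegree_pow, Polynomial.natDegree_X_sub_C, mul_one]
  have hmon : ((Polynomial.X - Polynomial.C f) ^ (q - 1)).coeff (q - 1) = 1 := by
    have := (Polynomial.monic_X_sub_C f).pow (q - 1)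
    rwa [Polynomial.Monic, Polynomial.leadingCoeff, hdeg] at this
  ext1 j
  rw [coeff_cartierOp hq, Polynomial.coeff_mul_C, Polynomial.coeff_C]
  split_ifs with hj
  · rw [hj, mul_zero, zero_add, hmon, one_mul]
  · have : 0 < q * j := Nat.mul_pos hq (Nat.pos_of_ne_zero hj)
    rw [Polynomial.coeff_eq_zero_of_natDegree_lt (by omega), zero_mul, sectionOp_zero]

/-- The Cartier operator is compatible with residues at `y = f`. Divided by `(y - f) ^ q`, the
polynomial on the left is a function with at most a simple pole at `f`, of residue `U(f)`. -/
theorem eval_cartierOp [Field F] [Fintype F] {r : ℕ} (hr : r < Fintype.card F)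
    (f : F⟦X⟧) (U : F⟦X⟧[X]) :
    (cartierOp (Fintype.card F) r
      ((Polynomial.X - Polynomial.C f) ^ (Fintype.card F - 1) * U)).eval f =
      sectionOp (Fintype.card F) r (U.eval f) := by
  have hq : 0 < Fintype.card F := Fintype.card_pos
  obtain ⟨W, hW⟩ := Polynomial.X_sub_C_dvd_sub_C_eval (a := f) (p := U)
  -- Only the constant term of the expansion of `U` in powers of `y - f` contributes.
  have hU : (Polynomial.X - Polynomial.C f) ^ (Fintype.card F - 1) * U =
      (Polynomial.X - Polynomial.C f) ^ (Fintype.card F - 1) * Polynomial.C (U.eval f) +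
        (Polynomial.X - Polynomial.C f) ^ Fintype.card F * W := by
    nth_rewrite 3 [← Nat.sub_add_cancel hq]
    rw [pow_succ, mul_assoc, ← hW]
    ring
  rw [hU, cartierOp_add hq, cartierOp_X_sub_C_pow_mul_C hq, cartierOp_X_sub_C_pow_card_mul hr]
  simp

/-! ### Bounded quotients by the derivative -/

/-- The coefficients of `V` are polynomials in `x` of degree at most `N`. -/
def CoeffDegreeLE [Semiring F] (V : F⟦X⟧[X]) (N : ℕ) : Prop :=
  ∀ i n, N < n → PowerSeries.coeff n (V.coeff i) = 0

theorem CoeffDegreeLE.mul [Semiring F] {V W : F⟦X⟧[X]} {M N : ℕ}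
    (hV : CoeffDegreeLE V M) (hW : CoeffDegreeLE W N) : CoeffDegreeLE (V * W) (M + N) := by
  intro i n hn
  rw [Polynomial.coeff_mul, map_sum]
  refine Finset.sum_eq_zero fun x _ => ?_
  rw [PowerSeries.coeff_mul]
  refine Finset.sum_eq_zero fun y hy => ?_
  rw [Finset.HasAntidiagonal.mem_antidiagonal] at hy
  rcases Nat.lt_or_ge M y.1 with h | h
  · rw [hV _ _ h, zero_mul]
  · rw [hW _ y.2 (by omega), mul_zero]

theorem CoeffDegreeLE.pow [Semiring F] {V : F⟦X⟧[X]} {M : ℕ}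
    (hV : CoeffDegreeLE V M) (k : ℕ) : CoeffDegreeLE (V ^ k) (k * M) := by
  induction k with
  | zero =>
    intro i n hn
    rw [zero_mul] at hn
    rw [pow_zero, Polynomial.coeff_one]
    split_ifs <;> simp [PowerSeries.coeff_one, hn.ne']
  | succ k ih => rw [pow_succ, add_mul, one_mul]; exact ih.mul hV

theorem CoeffDegreeLE.X_mul_derivative [Semiring F] {V : F⟦X⟧[X]} {M : ℕ}
    (hV : CoeffDegreeLE V M) :
    CoeffDegreeLE (Polynomial.X * Polynomial.derivative V) M := by
  intro i n hn
  rcases i with _ | i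
  · simp
  · rw [Polynomial.coeff_X_mul, Polynomial.coeff_derivative, ← Nat.cast_succ, ← nsmul_eq_mul',
      map_nsmul, hV _ _ hn, smul_zero]

theorem CoeffDegreeLE.cartierOp [Semiring F] {V : F⟦X⟧[X]} {q M : ℕ} (hq : 0 < q) (r : ℕ)
    (hV : CoeffDegreeLE V (q * M)) : CoeffDegreeLE (cartierOp q r V) M := by
  intro i n hn
  rw [coeff_cartierOp hq, coeff_sectionOp]
  exact hV _ _ (lt_of_lt_of_le (Nat.mul_lt_mul_of_pos_left hn hq) (Nat.le_add_right _ _))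

/-- The power series of the form `A(x, f) / D`, where `A` is a polynomial in `x` and `y`, of degree
at most `h` in `x` and less than `d` in `y`. The condition on `A` is not written as
`A.natDegree < d`, which would not allow `A = 0` when `d = 0`. -/
def residueSet [Semiring F] (f D : F⟦X⟧) (h d : ℕ) : Set F⟦X⟧ :=
  {g | ∃ A : F⟦X⟧[X], CoeffDegreeLE A h ∧ (∀ i, d ≤ i → A.coeff i = 0) ∧ D * g = A.eval f}

/-- The stability of the set of states, with one degree in `y` gained: the numerator `A` may have
degree `d` in `y`, whereas the numerators of the elements of `residueSet` have degree less
than `d`. -/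
theorem sectionOp_mem_residueSet [Field F] [Fintype F] {f g : F⟦X⟧} {P A : F⟦X⟧[X]} {h d r : ℕ}
    (hr : r < Fintype.card F) (hroot : P.eval f = 0)
    (hPh : CoeffDegreeLE P h) (hPd : P.natDegree ≤ d)
    (hAh : CoeffDegreeLE A h) (hAd : A.natDegree ≤ d)
    (hg : (Polynomial.derivative P).eval f * g = A.eval f) :
    sectionOp (Fintype.card F) r g ∈
      residueSet f ((Polynomial.derivative P).eval f) h d := by
  have hq : 0 < Fintype.card F := Fintype.card_pos
  have hq1 : 1 < Fintype.card F := Fintype.one_lt_card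
  refine ⟨cartierOp (Fintype.card F) r (A * P ^ (Fintype.card F - 1)), ?_, ?_, ?_⟩
  · refine CoeffDegreeLE.cartierOp hq r ?_
    have := hAh.mul (hPh.pow (Fintype.card F - 1))
    rwa [← one_add_mul, Nat.add_sub_cancel' hq1.le] at this
  · intro i hi
    -- The coefficient in question is that of `y ^ (q i + q - 1)`, and `q i + q - 1 > q d` as `q > 1`.
    have h1 : (A * P ^ (Fintype.card F - 1)).natDegree ≤ Fintype.card F * d := by
      calc _ ≤ A.natDegree + (Fintype.card F - 1) * P.natDegree :=
            Polynomial.natDegree_mul_le_of_le le_rfl Polynomial.natDegree_pow_le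
        _ ≤ d + (Fintype.card F - 1) * d := by gcongr
        _ = Fintype.card F * d := by rw [← one_add_mul, Nat.add_sub_cancel' hq1.le]
    have h2 : Fintype.card F * d ≤ Fintype.card F * i := Nat.mul_le_mul_left _ hi
    rw [coeff_cartierOp hq, Polynomial.coeff_eq_zero_of_natDegree_lt (by omega), sectionOp_zero]
  · obtain ⟨Q, hQ⟩ := Polynomial.dvd_iff_isRoot.mpr hroot
    have hD : (Polynomial.derivative P).eval f = Q.eval f := by
      rw [hQ]; simp
    have hV : A * P ^ (Fintype.card F - 1) =
        (Polynomial.X - Polynomial.C f) ^ (Fintype.card F - 1) *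
          (A * Q ^ (Fintype.card F - 1)) := by
      rw [hQ, mul_pow]; ring
    rw [hV, eval_cartierOp hr, Polynomial.eval_mul, Polynomial.eval_pow, ← hg, hD,
      ← sectionOp_pow_card_mul hr]
    congr 1
    nth_rewrite 1 [← Nat.sub_add_cancel hq]
    ring

/-- An element of `residueSet` is determined by the `(h + 1) * d` coefficients of its numerator. -/
theorem finite_residueSet_and_card_le [Field F] [Fintype F] (f : F⟦X⟧) {D : F⟦X⟧} (hD : D ≠ 0)
    (h d : ℕ) :
    (residueSet f D h d).Finite ∧
      (residueSet f D h d).ncard ≤ Fintype.card F ^ ((h + 1) * d) := by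
  choose A hAh hAd hA using fun g : residueSet f D h d => g.2
  let φ : residueSet f D h d → (Fin (h + 1) × Fin d → F) := fun g x =>
    PowerSeries.coeff (x.1 : ℕ) ((A g).coeff (x.2 : ℕ))
  have hφ : Function.Injective φ := by
    intro g k hgk
    have hAA : A g = A k := by
      ext i n
      by_cases hi : i < d
      · by_cases hn : n < h + 1
        · exact congrFun hgk (⟨n, hn⟩, ⟨i, hi⟩)
        · rw [hAh g i n (by omega), hAh k i n (by omega)]
      · rw [hAd g i (by omega), hAd k i (by omega)]
    exact Subtype.ext (mul_left_cancel₀ hD (by rw [hA g, hA k, hAA]))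
  refine ⟨Finite.of_injective φ hφ, ?_⟩
  have := Nat.card_le_card_of_injective φ hφ
  simpa [Set.ncard, Nat.card_eq_fintype_card] using this

/-! ### The automaton of a set stable under the section operators -/

/-- In the state `g`, reading the digit `r` leads to `Λ_r g`, and the output is `g(0)`. -/
theorem generatedWithStates_ncard [Semiring F] {q : ℕ} {S : Set F⟦X⟧} (hS : S.Finite)
    {f : F⟦X⟧} (hf : f ∈ S) (hstep : ∀ g ∈ S, ∀ r < q, sectionOp q r g ∈ S) :
    GeneratedWithStates q (fun n => PowerSeries.coeff n f) S.ncard := by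
  have : Finite S := hS
  let e : S ≃ Fin S.ncard := Finite.equivFin S
  let M : DFAO (Fin q) (Fin S.ncard) F :=
    { step := fun s i => e ⟨sectionOp q i (e.symm s), hstep _ (e.symm s).2 i i.2⟩
      start := e ⟨f, hf⟩
      output := fun s => PowerSeries.coeff 0 (e.symm s : F⟦X⟧) }
  have key : ∀ (w : List (Fin q)) (s : Fin S.ncard),
      M.output (w.foldl M.step s) =
        PowerSeries.coeff (wordValue w) (e.symm s : F⟦X⟧) := by
    intro w
    induction w with
    | nil => intro s; simp [M, wordValue]
    | cons i w ih =>
      intro s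
      rw [List.foldl_cons, ih]
      simp [M, wordValue, Nat.ofDigits_cons, add_comm]
  refine ⟨M, fun w => ?_⟩
  rw [DFAO.run, key]
  simp [M]

/-! ### The polynomial of a power series and its two partial derivatives -/

theorem coeff_coeff_swap [CommSemiring F] (P : F[X][X]) (i n : ℕ) :
    ((Bivariate.swap P).coeff n).coeff i = (P.coeff i).coeff n := by
  induction P using Polynomial.induction_on' with
  | add P Q hP hQ => simp only [map_add, Polynomial.coeff_add, hP, hQ]
  | monomial j c =>
    induction c using Polynomial.induction_on' with
    | add a b ha hb => simp only [map_add, Polynomial.coeff_add, ha, hb]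
    | monomial m r =>
      rw [Bivariate.swap_monomial_monomial]
      simp only [Polynomial.coeff_monomial]
      split_ifs <;> simp_all [Polynomial.coeff_monomial]

theorem degreeInX_eq_natDegree_swap [Field F] (P : F[X][X]) :
    degreeInX P = (Bivariate.swap P).natDegree := by
  refine le_antisymm (Finset.sup_le fun i _ => ?_) ?_
  · rw [Polynomial.natDegree_le_iff_coeff_eq_zero]
    intro n hn
    rw [← coeff_coeff_swap, Polynomial.coeff_eq_zero_of_natDegree_lt hn, Polynomial.coeff_zero]
  · rw [Polynomial.natDegree_le_iff_coeff_eq_zero]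
    intro n hn
    ext i
    rw [coeff_coeff_swap, Polynomial.coeff_zero]
    by_cases hi : i ∈ P.support
    · exact Polynomial.coeff_eq_zero_of_natDegree_lt
        (lt_of_le_of_lt (Finset.le_sup (f := fun i => (P.coeff i).natDegree) hi) hn)
    · rw [Polynomial.notMem_support_iff.mp hi, Polynomial.coeff_zero]

theorem degreeInX_le_of_dvd [Field F] {P Q : F[X][X]} (h : P ∣ Q) (hQ : Q ≠ 0) :
    degreeInX P ≤ degreeInX Q := by
  obtain ⟨R, rfl⟩ := h
  have hinj := (Bivariate.swap (R := F)).injective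
  rw [degreeInX_eq_natDegree_swap, degreeInX_eq_natDegree_swap, map_mul,
    Polynomial.natDegree_mul ((map_ne_zero_iff _ hinj).mpr (left_ne_zero_of_mul hQ))
      ((map_ne_zero_iff _ hinj).mpr (right_ne_zero_of_mul hQ))]
  exact Nat.le_add_right _ _

/-- The partial derivative `P_x` of a polynomial `P(x, y)`, viewed as a polynomial in `y`. -/
def derivativeX [CommSemiring F] (P : F[X][X]) : F[X][X] :=
  Bivariate.swap (Polynomial.derivative (Bivariate.swap P))

theorem coeff_derivativeX [CommSemiring F] (P : F[X][X]) (i : ℕ) :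
    (derivativeX P).coeff i = Polynomial.derivative (P.coeff i) := by
  ext n
  rw [derivativeX, coeff_coeff_swap, Polynomial.coeff_derivative, Polynomial.coeff_derivative,
    ← coeff_coeff_swap P, ← Nat.cast_succ, ← Nat.cast_succ, ← nsmul_eq_mul', ← nsmul_eq_mul',
    Polynomial.coeff_smul]

theorem algebraMap_eq_coe [Field F] (c : F[X]) : algebraMap F[X] F⟦X⟧ c = (c : F⟦X⟧) := by
  rw [PowerSeries.algebraMap_apply', Algebra.algebraMap_self, PowerSeries.map_id]
  rfl

/-- The chain rule for `P(x, f(x))`. -/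
theorem derivative_aeval [Field F] (f : F⟦X⟧) (P : F[X][X]) :
    PowerSeries.derivative F (aeval f P) =
      aeval f (derivativeX P) +
        aeval f (Polynomial.derivative P) * PowerSeries.derivative F f := by
  induction P using Polynomial.induction_on' with
  | add P Q hP hQ =>
    have : derivativeX (P + Q) = derivativeX P + derivativeX Q := by simp [derivativeX]
    rw [this]
    simp only [map_add, hP, hQ]
    ring
  | monomial j c =>
    have h : derivativeX (Polynomial.monomial j c) =
        Polynomial.monomial j (Polynomial.derivative c) := by
      ext1 i
      rw [coeff_derivativeX, Polynomial.coeff_monomial, Polynomial.coeff_monomial]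
      split_ifs <;> simp
    rw [h, Polynomial.derivative_monomial]
    simp only [Polynomial.aeval_monomial, algebraMap_eq_coe, Derivation.leibniz,
      Derivation.leibniz_pow, PowerSeries.derivative_coe, smul_eq_mul, nsmul_eq_mul]
    simp only [← algebraMap_eq_coe, map_mul, map_natCast]
    ring

/-- If both partial derivatives of `P(x, y)` vanish, then `P` is a polynomial in `x ^ p` and
`y ^ p`, hence a `p`-th power as the field is perfect. -/
theorem exists_pow_eq_of_derivative_eq_zero [Field F] [Finite F] {p : ℕ} [Fact p.Prime]
    [CharP F p] {P : F[X][X]} (hy : Polynomial.derivative P = 0) (hx : derivativeX P = 0) :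
    ∃ S : F[X][X], S ^ p = P := by
  have hp : p ≠ 0 := (Fact.out : p.Prime).ne_zero
  have hroot : ∀ c : F[X], Polynomial.derivative c = 0 → ∃ s : F[X], s ^ p = c := by
    intro c hc
    have : PerfectRing F p := PerfectRing.ofFiniteOfIsReduced p F
    exact ⟨(Polynomial.contract p c).map (frobeniusEquiv F p).symm,
      by rw [← polynomial_expand_eq, Polynomial.expand_contract p hc hp]⟩
  have hcoeff : ∀ i, ∃ s : F[X], s ^ p = P.coeff i := fun i =>
    hroot _ (by rw [← coeff_derivativeX, hx, Polynomial.coeff_zero])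
  choose s hs using hcoeff
  have hG := Polynomial.expand_contract p hy hp
  refine ⟨∑ j ∈ Finset.range ((Polynomial.contract p P).natDegree + 1),
    Polynomial.monomial j (s (j * p)), ?_⟩
  rw [sum_pow_char]
  conv_rhs => rw [← hG, (Polynomial.contract p P).as_sum_range' _ (Nat.lt_succ_self _)]
  rw [map_sum]
  refine Finset.sum_congr rfl fun j _ => ?_
  rw [Polynomial.monomial_pow, hs, Polynomial.expand_monomial, Polynomial.coeff_contract hp]

/-! ### Irreducible equations of an algebraic power series -/

theorem exists_irreducible_factor_aeval_eq_zero [Field F] {f : F⟦X⟧} {Q : F[X][X]} (hQ : Q ≠ 0)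
    (hf : aeval f Q = 0) : ∃ P : F[X][X], Irreducible P ∧ P ∣ Q ∧ aeval f P = 0 := by
  induction Q using WfDvdMonoid.induction_on_irreducible with
  | zero => exact absurd rfl hQ
  | unit u hu => exact absurd hf (hu.map (aeval f)).ne_zero
  | mul a i ha hi ih =>
    rw [map_mul, mul_eq_zero] at hf
    rcases hf with hf | hf
    · exact ⟨i, hi, dvd_mul_right _ _, hf⟩
    · obtain ⟨P, h1, h2, h3⟩ := ih ha hf
      exact ⟨P, h1, h2.mul_left _, h3⟩

theorem natDegree_ne_zero_of_aeval_eq_zero [Field F] {f : F⟦X⟧} {P : F[X][X]} (hP : P ≠ 0)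
    (hf : aeval f P = 0) : P.natDegree ≠ 0 := by
  intro h
  obtain ⟨c, rfl⟩ := Polynomial.natDegree_eq_zero.mp h
  rw [Polynomial.aeval_C, algebraMap_eq_coe, Polynomial.coe_eq_zero_iff] at hf
  exact hP (by rw [hf, Polynomial.C_0])

theorem algebraMap_laurentSeries_eq [Field F] (c : F[X]) :
    algebraMap F[X] F⸨X⸩ c = ((algebraMap F[X] F⟦X⟧ c : F⟦X⟧) : F⸨X⸩) := by
  rw [algebraMap_eq_coe]
  rfl

theorem aeval_coe_laurentSeries [Field F] (f : F⟦X⟧) (P : F[X][X]) :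
    aeval (f : F⸨X⸩) P = ((aeval f P : F⟦X⟧) : F⸨X⸩) := by
  have h : algebraMap F[X] F⸨X⸩ =
      (HahnSeries.ofPowerSeries ℤ F).comp (algebraMap F[X] F⟦X⟧) :=
    RingHom.ext algebraMap_laurentSeries_eq
  rw [Polynomial.aeval_def, Polynomial.aeval_def, h, Polynomial.hom_eval₂]

theorem aeval_coe_map_ratFunc [Field F] (f : F⟦X⟧) (P : F[X][X]) :
    aeval (f : F⸨X⸩) (P.map (algebraMap F[X] (RatFunc F))) =
      ((aeval f P : F⟦X⟧) : F⸨X⸩) := by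
  rw [Polynomial.aeval_map_algebraMap, aeval_coe_laurentSeries]

/-- By Gauss's lemma, `P` stays irreducible over `F(x)`. -/
theorem associated_map_minpoly [Field F] {f : F⟦X⟧} {P : F[X][X]} (hP : Irreducible P)
    (hf : aeval f P = 0) :
    Associated (P.map (algebraMap F[X] (RatFunc F))) (minpoly (RatFunc F) (f : F⸨X⸩)) := by
  have hprim := hP.isPrimitive (natDegree_ne_zero_of_aeval_eq_zero hP.ne_zero hf)
  have hirr := (hprim.irreducible_iff_irreducible_map_fraction_map (K := RatFunc F)).mp hP
  have h0 : aeval (f : F⸨X⸩) (P.map (algebraMap F[X] (RatFunc F))) = 0 := by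
    rw [aeval_coe_map_ratFunc, hf, PowerSeries.coe_zero]
  rw [← minpoly.eq_of_irreducible hirr h0]
  exact (associated_mul_unit_right _ _ (Polynomial.isUnit_C.mpr
    (isUnit_iff_ne_zero.mpr (inv_ne_zero (Polynomial.leadingCoeff_ne_zero.mpr hirr.ne_zero)))))

theorem dvd_of_aeval_eq_zero [Field F] {f : F⟦X⟧} {P Q : F[X][X]} (hP : Irreducible P)
    (hf : aeval f P = 0) (hQ : aeval f Q = 0) : P ∣ Q := by
  have hprim := hP.isPrimitive (natDegree_ne_zero_of_aeval_eq_zero hP.ne_zero hf)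
  refine hprim.dvd_of_fraction_map_dvd_fraction_map (K := RatFunc F) ?_
  refine (associated_map_minpoly hP hf).dvd.trans (minpoly.dvd _ _ ?_)
  rw [aeval_coe_map_ratFunc, hQ, PowerSeries.coe_zero]

theorem natDegree_eq_seriesDegree [Field F] {f : F⟦X⟧} {P : F[X][X]} (hP : Irreducible P)
    (hf : aeval f P = 0) (halg : IsAlgebraicSeries f) : P.natDegree = seriesDegree f := by
  rw [seriesDegree, adjoin.finrank (isAlgebraic_iff_isIntegral.mp halg),
    ← Polynomial.natDegree_eq_of_degree_eq
      (Polynomial.degree_eq_degree_of_associated (associated_map_minpoly hP hf)),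
    Polynomial.natDegree_map_eq_of_injective (IsFractionRing.injective F[X] (RatFunc F))]

/-- An algebraic power series over a finite field is separable over `F(x)`. -/
theorem aeval_derivative_ne_zero [Field F] [Finite F] {f : F⟦X⟧} {P : F[X][X]}
    (hP : Irreducible P) (hf : aeval f P = 0) : aeval f (Polynomial.derivative P) ≠ 0 := by
  intro h0
  obtain ⟨p, hp⟩ := CharP.exists F
  have : Fact p.Prime := ⟨CharP.char_is_prime F p⟩
  have hy : Polynomial.derivative P = 0 := by
    by_contra hne
    exact (Polynomial.natDegree_derivative_lt
      (natDegree_ne_zero_of_aeval_eq_zero hP.ne_zero hf)).not_ge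
      (Polynomial.natDegree_le_of_dvd (dvd_of_aeval_eq_zero hP hf h0) hne)
  have hx : derivativeX P = 0 := by
    by_contra hne
    have hroot : aeval f (derivativeX P) = 0 := by
      have := derivative_aeval f P
      rwa [hf, hy, map_zero, map_zero, zero_mul, add_zero, eq_comm] at this
    have hle := degreeInX_le_of_dvd (dvd_of_aeval_eq_zero hP hf hroot) hne
    rw [degreeInX_eq_natDegree_swap, degreeInX_eq_natDegree_swap, derivativeX,
      Bivariate.swap_swap_apply] at hle
    have hdeg : (Bivariate.swap P).natDegree ≠ 0 := by
      intro hd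
      obtain ⟨c, hc⟩ := Polynomial.natDegree_eq_zero.mp hd
      exact hne (by rw [derivativeX, ← hc, Polynomial.derivative_C, map_zero])
    exact (Polynomial.natDegree_derivative_lt hdeg).not_ge hle
  obtain ⟨S, hS⟩ := exists_pow_eq_of_derivative_eq_zero (p := p) hy hx
  exact not_irreducible_pow (Fact.out : p.Prime).ne_one (hS ▸ hP)

theorem exists_irreducible_degreeInX_le_seriesHeight [Field F] {f : F⟦X⟧}
    (halg : IsAlgebraicSeries f) :
    ∃ P : F[X][X], Irreducible P ∧ aeval f P = 0 ∧ degreeInX P ≤ seriesHeight f := by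
  have hne : {h : ℕ | ∃ P : F[X][X], P ≠ 0 ∧ aeval f P = 0 ∧ degreeInX P = h}.Nonempty := by
    obtain ⟨Q, hQ, hQf⟩ := (IsFractionRing.isAlgebraic_iff F[X] (RatFunc F) F⸨X⸩).mpr halg
    refine ⟨_, Q, hQ, ?_, rfl⟩
    rw [aeval_coe_laurentSeries] at hQf
    exact HahnSeries.ofPowerSeries_injective (hQf.trans PowerSeries.coe_zero.symm)
  obtain ⟨Q, hQ, hQf, hQh⟩ := Nat.sInf_mem hne
  obtain ⟨P, hP, hPQ, hPf⟩ := exists_irreducible_factor_aeval_eq_zero hQ hQf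
  exact ⟨P, hP, hPf, (degreeInX_le_of_dvd hPQ hQ).trans hQh.le⟩

/-! ### The number of states -/

theorem exists_le_and_generatedWithStates [Field F] [Fintype F] {f : F⟦X⟧}
    (halg : IsAlgebraicSeries f) :
    ∃ m ≤ Fintype.card F ^ ((seriesHeight f + 1) * seriesDegree f) + 1,
      GeneratedWithStates (Fintype.card F) (fun n => PowerSeries.coeff n f) m := by
  obtain ⟨P, hP, hPf, hPh⟩ := exists_irreducible_degreeInX_le_seriesHeight halg
  have hPd := natDegree_eq_seriesDegree hP hPf halg
  have hD := aeval_derivative_ne_zero hP hPf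
  let R : F⟦X⟧[X] := P.map (algebraMap F[X] F⟦X⟧)
  have hroot : R.eval f = 0 := by rw [Polynomial.eval_map_algebraMap, hPf]
  have hRD : (Polynomial.derivative R).eval f = aeval f (Polynomial.derivative P) := by
    rw [Polynomial.derivative_map, Polynomial.eval_map_algebraMap]
  have hRd : R.natDegree ≤ seriesDegree f := Polynomial.natDegree_map_le.trans hPd.le
  have hRh : CoeffDegreeLE R (seriesHeight f) := by
    intro i n hn
    rw [Polynomial.coeff_map, algebraMap_eq_coe, Polynomial.coeff_coe, ← coeff_coeff_swap,
      Polynomial.coeff_eq_zero_of_natDegree_lt (n := n), Polynomial.coeff_zero]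
    rw [← degreeInX_eq_natDegree_swap]
    exact hPh.trans_lt hn
  have hRD0 : (Polynomial.derivative R).eval f ≠ 0 := hRD ▸ hD
  obtain ⟨hfin, hcard⟩ := finite_residueSet_and_card_le f hRD0 (seriesHeight f) (seriesDegree f)
  refine ⟨_, (Set.ncard_insert_le f _).trans (Nat.add_le_add_right hcard 1),
    generatedWithStates_ncard (hfin.insert f) (Set.mem_insert f _) ?_⟩
  rintro g (rfl | ⟨A, hAh, hAd, hA⟩) r hr
  -- The state `f` is the quotient with numerator `y * P_y`, whose degree in `y` may be `d`.
  · refine Or.inr (sectionOp_mem_residueSet hr hroot hRh hRd hRh.X_mul_derivative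
      (Polynomial.natDegree_le_iff_coeff_eq_zero.mpr fun n hn => ?_) ?_)
    · rcases n with _ | n
      · simp
      · rw [Polynomial.coeff_X_mul, Polynomial.coeff_derivative,
          Polynomial.coeff_eq_zero_of_natDegree_lt (hRd.trans_lt hn), zero_mul]
    · rw [Polynomial.eval_mul, Polynomial.eval_X, mul_comm]
  · exact Or.inr (sectionOp_mem_residueSet hr hroot hRh hRd hAh
      (Polynomial.natDegree_le_iff_coeff_eq_zero.mpr fun n hn => hAd n hn.le) hA)

end

theorem mainTheorem2 :
    ∃ ε : ℕ → ℕ → ℕ → ℝ,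
      (∀ η : ℝ, 0 < η → ∃ N : ℕ, ∀ q h d : ℕ, N ≤ q ∨ N ≤ h ∨ N ≤ d → |ε q h d| ≤ η) ∧
      ∀ (F : Type*) [Field F] [Fintype F] (q h d : ℕ) (f : PowerSeries F),
        Fintype.card F = q → IsAlgebraicSeries f → seriesDegree f = d → seriesHeight f = h →
          IsAutomaticReverse q (fun n => PowerSeries.coeff n f) ∧
          (reverseComplexity q (fun n => PowerSeries.coeff n f) : ℝ) ≤
            (1 + ε q h d) * (q : ℝ) ^ ((h + 1) * d + 1) := by
  refine ⟨fun _ _ _ => 0, fun η hη => ⟨0, fun _ _ _ _ => by simpa using hη.le⟩, ?_⟩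
  rintro F _ _ q h d f rfl halg rfl rfl
  obtain ⟨m, hm, hgen⟩ := exists_le_and_generatedWithStates halg
  refine ⟨⟨m, hgen⟩, ?_⟩
  have hq : 2 ≤ Fintype.card F := Fintype.one_lt_card
  have hle : reverseComplexity (Fintype.card F) (fun n => PowerSeries.coeff n f) ≤
      Fintype.card F ^ ((seriesHeight f + 1) * seriesDegree f + 1) := by
    calc _ ≤ m := Nat.sInf_le hgen
      _ ≤ Fintype.card F ^ ((seriesHeight f + 1) * seriesDegree f) + 1 := hm
      _ ≤ Fintype.card F ^ ((seriesHeight f + 1) * seriesDegree f) +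
          Fintype.card F ^ ((seriesHeight f + 1) * seriesDegree f) :=
        Nat.add_le_add_left (Nat.one_le_pow _ _ (by omega)) _
      _ = Fintype.card F ^ ((seriesHeight f + 1) * seriesDegree f) * 2 := by ring
      _ ≤ Fintype.card F ^ ((seriesHeight f + 1) * seriesDegree f) * Fintype.card F :=
        Nat.mul_le_mul_left _ hq
      _ = _ := (pow_succ _ _).symm
  rw [add_zero, one_mul]
  exact_mod_cast hle
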